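/- Let $(M,d)$ be a bounded metric space, $X$ a (real) Banach space and $\alpha\ge 0$. Let $\varphi:M\to 2^X$ be a set-valued map with non-empty, closed and convex values such that: (i) $\varphi$ is lower hemicontinuous: for every $a\in M$ and every open $U\subseteq X$ with $\varphi(a)\cap U\neq\emptyset$ there is an open $V\ni a$ in $M$ with $\varphi(v)\cap U\neq\emptyset$ for all $v\in V$; (ii) for every $\varepsilon>0$, $\varphi$ is lower pointwise $(\alpha+\varepsilon)$-Lipschitz: for all $b\in M$, $y\in\varphi(b)$ and $a\in M$, there is $x\in\varphi(a)$ with $\|x-y\|\le(\alpha+\varepsilon)\,d(b,a)$. Then for every $\beta>\alpha$ there exist a bounded continuous map $f:M\to X$ with $f(a)\in\varphi(a)$ for all $a\in M$, and a dense set $S\subseteq M$, such that $f$ is pointwise $\beta$-Lipschitz on $S$, i.e., for every $b\in S$, $$\limsup_{r\to0^+}\ r^{-1}\sup\{\|f(b)-f(a)\| : a\in M,\ d(a,b)\le r\}\le\beta .$$ -/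

import Mathlib

open Filter Topology
open scoped NNReal ENNReal

/-- `f` is pointwise `α`-Lipschitz at `b`:
`limsup_{r → 0⁺} r⁻¹ * sup {d (f b) (f a) | a ∈ closedBall b r} ≤ α`,
with suprema and the limit superior computed in `[0, ∞]`. -/
def PointwiseLipschitzAt {M N : Type*} [MetricSpace M] [MetricSpace N]
    (α : ℝ≥0) (f : M → N) (b : M) : Prop :=
  limsup (fun r : ℝ =>
      (ENNReal.ofReal r)⁻¹ * ⨆ a ∈ Metric.closedBall b r, edist (f b) (f a))
    (𝓝[>] (0 : ℝ)) ≤ (α : ℝ≥0∞)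

/-- `f` is pointwise `α`-Lipschitz at every point of `S`. -/
def PointwiseLipschitzOn {M N : Type*} [MetricSpace M] [MetricSpace N]
    (α : ℝ≥0) (f : M → N) (S : Set M) : Prop :=
  ∀ b ∈ S, PointwiseLipschitzAt α f b

/-- `φ` is lower pointwise `α`-Lipschitz at `b`: for all `y ∈ φ b` and all `a`, the set `φ a`
meets the closed ball about `y` of radius `α * d b a`. -/
def LowerPointwiseLipschitzAt {M X : Type*} [MetricSpace M] [NormedAddCommGroup X]
    (α : ℝ≥0) (φ : M → Set X) (b : M) : Prop :=
  ∀ y ∈ φ b, ∀ a : M, (φ a ∩ Metric.closedBall y (α * dist b a)).Nonempty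

/-- `φ` is lower pointwise `α`-Lipschitz at every point. -/
def LowerPointwiseLipschitz {M X : Type*} [MetricSpace M] [NormedAddCommGroup X]
    (α : ℝ≥0) (φ : M → Set X) : Prop :=
  ∀ b : M, LowerPointwiseLipschitzAt α φ b

/-- `f` is a selection of the correspondence `φ`. -/
def IsSelection {A B : Type*} (φ : A → Set B) (f : A → B) : Prop :=
  ∀ a : A, f a ∈ φ a

/-! Fix α < κ < γ < β. Cutting φ by the cone of slope γ at a point (b, y) of its graph leaves a
lower hemicontinuous map, because φ already meets the narrower cone of slope κ; Michael's theorem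
then gives selections growing at rate at most γ from (b, y). Local pieces of such selections are
glued into a given one around a separated set (`exists_perturbed_selection`). Iterating over finer
nets with dense union, each correction vanishes linearly at the earlier net points, and the
coefficients sum to at most β - γ. So the slope γ obtained when a point enters the net becomes at
most β in the uniform limit. -/

/-! ### Michael selection by successive approximation. -/

section MichaelSelection

variable {M X : Type*} [MetricSpace M] [NormedAddCommGroup X] [NormedSpace ℝ X]

/-- A continuous approximate selection of a lower hemicontinuous convex-valued correspondence can be
refined to a better one that stays uniformly close to it. -/
theorem LowerHemicontinuous.exists_continuous_thickening_near {ψ : M → Set X}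
    (hψ : LowerHemicontinuous ψ) (hconv : ∀ a, Convex ℝ (ψ a)) {f : M → X} (hf : Continuous f)
    {r s : ℝ} (hfr : ∀ a, f a ∈ Metric.thickening r (ψ a)) (hs : 0 < s) :
    ∃ g : M → X, Continuous g ∧ ∀ a, g a ∈ Metric.thickening s (ψ a) ∧ dist (f a) (g a) < r := by
  obtain ⟨g, hg⟩ := exists_continuous_forall_mem_convex_of_local_const
    (t := fun a ↦ Metric.thickening s (ψ a) ∩ Metric.ball (f a) r)
    (fun a ↦ ((hconv a).thickening s).inter (convex_ball _ _)) fun p ↦ by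
      -- A point of `ψ p` close to `f p` serves as a constant local solution; convexity lets a
      -- partition of unity glue these.
      obtain ⟨c, hc, hcr⟩ := Metric.mem_thickening_iff.1 (hfr p)
      refine ⟨c, ?_⟩
      have h1 : ∀ᶠ y in 𝓝 p, (ψ y ∩ Metric.ball c s).Nonempty :=
        lowerHemicontinuousAt_iff.1 (hψ p) _ Metric.isOpen_ball ⟨c, hc, Metric.mem_ball_self hs⟩
      have h2 : ∀ᶠ y in 𝓝 p, dist (f y) c < r :=
        (hf.dist continuous_const).continuousAt.eventually_lt_const hcr
      filter_upwards [h1, h2] with y ⟨x, hx, hxc⟩ hy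
      exact ⟨Metric.mem_thickening_iff.2 ⟨x, hx, by rwa [dist_comm]⟩, by rwa [Metric.mem_ball']⟩
  exact ⟨g, g.continuous, fun a ↦ ⟨(hg a).1, Metric.mem_ball'.1 (hg a).2⟩⟩

theorem LowerHemicontinuous.exists_continuous_thickening {ψ : M → Set X}
    (hψ : LowerHemicontinuous ψ) (hconv : ∀ a, Convex ℝ (ψ a)) (hne : ∀ a, (ψ a).Nonempty)
    {s : ℝ} (hs : 0 < s) :
    ∃ g : M → X, Continuous g ∧ ∀ a, g a ∈ Metric.thickening s (ψ a) := by
  obtain ⟨g, hg⟩ := exists_continuous_forall_mem_convex_of_local_const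
    (t := fun a ↦ Metric.thickening s (ψ a)) (fun a ↦ (hconv a).thickening s) fun p ↦ by
      obtain ⟨c, hc⟩ := hne p
      refine ⟨c, ?_⟩
      have h1 : ∀ᶠ y in 𝓝 p, (ψ y ∩ Metric.ball c s).Nonempty :=
        lowerHemicontinuousAt_iff.1 (hψ p) _ Metric.isOpen_ball ⟨c, hc, Metric.mem_ball_self hs⟩
      filter_upwards [h1] with y ⟨x, hx, hxc⟩
      exact Metric.mem_thickening_iff.2 ⟨x, hx, by rwa [dist_comm]⟩
  exact ⟨g, g.continuous, hg⟩

/-- A uniform limit of continuous functions whose consecutive distances decay geometrically. -/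
theorem exists_continuous_limit_of_dist_le {Y : Type*} [MetricSpace Y] [CompleteSpace Y] {C : ℝ}
    {F : ℕ → M → Y} (hF : ∀ n, Continuous (F n))
    (hd : ∀ n a, dist (F n a) (F (n + 1) a) ≤ C / 2 / 2 ^ n) :
    ∃ f : M → Y, Continuous f ∧ (∀ a, Tendsto (fun n ↦ F n a) atTop (𝓝 (f a))) ∧
      ∀ n a, dist (F n a) (f a) ≤ C / 2 ^ n := by
  choose f hf using fun a ↦ cauchySeq_tendsto_of_complete
    (cauchySeq_of_le_geometric_two (fun n ↦ hd n a))
  have hle : ∀ n a, dist (F n a) (f a) ≤ C / 2 ^ n := fun n a ↦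
    dist_le_of_le_geometric_two_of_tendsto (fun n ↦ hd n a) (hf a) n
  have hlim : Tendsto (fun n : ℕ ↦ C / 2 ^ n) atTop (𝓝 0) := by
    simpa [div_eq_mul_inv] using
      (tendsto_pow_atTop_nhds_zero_of_lt_one (r := (2 : ℝ)⁻¹) (by norm_num) (by norm_num)).const_mul C
  refine ⟨f, ?_, hf, hle⟩
  have hunif : TendstoUniformly F f atTop := by
    rw [Metric.tendstoUniformly_iff]
    intro ε hε
    filter_upwards [hlim.eventually_lt_const hε] with n hn a
    rw [dist_comm]
    exact (hle n a).trans_lt hn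
  exact hunif.continuous (Frequently.of_forall hF)

/-- The Michael selection theorem over a metric space. -/
theorem LowerHemicontinuous.exists_continuous_selection [CompleteSpace X] {ψ : M → Set X}
    (hψ : LowerHemicontinuous ψ) (hconv : ∀ a, Convex ℝ (ψ a)) (hne : ∀ a, (ψ a).Nonempty)
    (hcl : ∀ a, IsClosed (ψ a)) : ∃ f : M → X, Continuous f ∧ IsSelection ψ f := by
  have hpos : ∀ n : ℕ, (0 : ℝ) < 1 / 2 / 2 ^ n := fun n ↦ by positivity
  obtain ⟨g₀, hg₀, hg₀'⟩ := hψ.exists_continuous_thickening hconv hne (hpos 0)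
  choose! N hN using fun (n : ℕ) (f : M → X)
      (h : Continuous f ∧ ∀ a, f a ∈ Metric.thickening (1 / 2 / 2 ^ n) (ψ a)) ↦
    hψ.exists_continuous_thickening_near hconv h.1 h.2 (hpos (n + 1))
  let F : ℕ → M → X := fun n ↦ Nat.rec g₀ N n
  have hF : ∀ n, Continuous (F n) ∧ ∀ a, F n a ∈ Metric.thickening (1 / 2 / 2 ^ n) (ψ a) := by
    intro n
    induction n with
    | zero => exact ⟨hg₀, hg₀'⟩
    | succ n ih => exact ⟨(hN n (F n) ih).1, fun a ↦ ((hN n (F n) ih).2 a).1⟩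
  obtain ⟨f, hfc, hf, hle⟩ := exists_continuous_limit_of_dist_le (fun n ↦ (hF n).1)
    (fun n a ↦ ((hN n (F n) (hF n)).2 a).2.le)
  refine ⟨f, hfc, fun a ↦ ?_⟩
  choose x hx hxd using fun n ↦ Metric.mem_thickening_iff.1 ((hF n).2 a)
  have hlim : Tendsto (fun n : ℕ ↦ (1 : ℝ) / 2 / 2 ^ n) atTop (𝓝 0) := by
    simpa [div_eq_mul_inv] using
      (tendsto_pow_atTop_nhds_zero_of_lt_one (r := (2 : ℝ)⁻¹)
        (by norm_num) (by norm_num)).const_mul (1 / 2 : ℝ)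
  refine (hcl a).mem_of_tendsto ((hf a).congr_dist ?_) (Eventually.of_forall hx)
  exact squeeze_zero (fun _ ↦ dist_nonneg) (fun n ↦ (hxd n).le) hlim

end MichaelSelection

/-! ### Selections in cones, and their gluing. -/

section LipschitzSelection

variable {M X : Type*} [MetricSpace M] [NormedAddCommGroup X] [NormedSpace ℝ X]

/-- Cutting a lower hemicontinuous, lower pointwise Lipschitz correspondence by the cone of slightly
larger slope at a point of its graph preserves lower hemicontinuity. -/
theorem LowerHemicontinuous.inter_closedBall_mul_dist {φ : M → Set X} (hφ : LowerHemicontinuous φ)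
    (hconv : ∀ a, Convex ℝ (φ a)) {κ γ : ℝ≥0} (hκγ : κ < γ) {b : M} {y : X}
    (hlip : ∀ a, (φ a ∩ Metric.closedBall y (κ * dist b a)).Nonempty) :
    LowerHemicontinuous fun a ↦ φ a ∩ Metric.closedBall y (γ * dist b a) := by
  have hκγ' : (κ : ℝ) < γ := hκγ
  refine lowerHemicontinuous_iff.2 fun a ↦ lowerHemicontinuousAt_iff.2 ?_
  rintro U hU ⟨x, ⟨hxφ, hxb⟩, hxU⟩
  have hcont : ∀ k : ℝ, Continuous fun v : M ↦ k * dist b v := fun k ↦ by fun_prop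
  rcases eq_or_ne a b with rfl | hab
  · obtain rfl : x = y := by simpa using hxb
    obtain ⟨ρ, hρ, hρU⟩ := Metric.isOpen_iff.1 hU x hxU
    have h : ∀ᶠ v in 𝓝 a, (γ : ℝ) * dist a v < ρ :=
      (hcont γ).continuousAt.eventually_lt_const (by simpa using hρ)
    filter_upwards [h] with v hv
    obtain ⟨z, hz, hzb⟩ := hlip v
    have hzγ : z ∈ Metric.closedBall x (γ * dist a v) :=
      Metric.closedBall_subset_closedBall (by gcongr) hzb
    exact ⟨z, ⟨hz, hzγ⟩, hρU (lt_of_le_of_lt hzγ hv)⟩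
  -- Away from the apex, moving `x` slightly towards a point of the κ-cone puts it strictly inside
  -- the γ-cone, an open condition that survives perturbing `a`.
  · have hd : 0 < dist b a := dist_pos.2 hab.symm
    obtain ⟨z, hz, hzb⟩ := hlip a
    have hline : Tendsto (fun t : ℝ ↦ AffineMap.lineMap x z t) (𝓝[>] (0 : ℝ)) (𝓝 x) := by
      have : Continuous fun t : ℝ ↦ (AffineMap.lineMap x z t : X) := AffineMap.lineMap_continuous
      simpa using (this.tendsto 0).mono_left nhdsWithin_le_nhds
    have hIoo : ∀ᶠ t : ℝ in 𝓝[>] 0, t ∈ Set.Ioo (0 : ℝ) 1 := Ioo_mem_nhdsGT one_pos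
    obtain ⟨t, htU, ht0, ht1⟩ := ((hline.eventually (hU.mem_nhds hxU)).and hIoo).exists
    set w : X := AffineMap.lineMap x z t with hw
    have hwφ : w ∈ φ a := (hconv a).lineMap_mem hxφ hz ⟨ht0.le, ht1.le⟩
    have hwlt : dist w y < γ * dist b a := by
      have h1 : w - y = (1 - t) • (x - y) + t • (z - y) := by
        rw [hw, AffineMap.lineMap_apply_module]; module
      have hx' : ‖x - y‖ ≤ γ * dist b a := by simpa [dist_eq_norm] using hxb
      have hz' : ‖z - y‖ ≤ κ * dist b a := by simpa [dist_eq_norm] using hzb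
      calc dist w y ≤ (1 - t) * ‖x - y‖ + t * ‖z - y‖ := by
            rw [dist_eq_norm, h1]
            refine (norm_add_le _ _).trans_eq ?_
            rw [norm_smul_of_nonneg (by linarith), norm_smul_of_nonneg ht0.le]
        _ ≤ (1 - t) * (γ * dist b a) + t * (κ * dist b a) := by
            have : 0 ≤ 1 - t := by linarith
            gcongr
        _ < γ * dist b a := by nlinarith [mul_pos ht0 (mul_pos (sub_pos.2 hκγ') hd)]
    obtain ⟨ρ, hwρ, hρ⟩ := exists_between hwlt
    have h1 : ∀ᶠ v in 𝓝 a, (φ v ∩ (U ∩ Metric.ball y ρ)).Nonempty :=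
      lowerHemicontinuousAt_iff.1 (hφ a) _ (hU.inter Metric.isOpen_ball) ⟨w, hwφ, htU, hwρ⟩
    have h2 : ∀ᶠ v in 𝓝 a, ρ < γ * dist b v := (hcont γ).continuousAt.eventually_const_lt hρ
    filter_upwards [h1, h2] with v ⟨u, huφ, huU, huρ⟩ hv
    exact ⟨u, ⟨huφ, (lt_trans huρ hv).le⟩, huU⟩

/-- Through every point of the graph there is a continuous selection with Lipschitz growth from
that point. -/
theorem LowerHemicontinuous.exists_continuous_selection_dist_le [CompleteSpace X] {φ : M → Set X}
    (hφ : LowerHemicontinuous φ) (hconv : ∀ a, Convex ℝ (φ a)) (hcl : ∀ a, IsClosed (φ a))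
    {κ γ : ℝ≥0} (hκγ : κ < γ) (hlip : LowerPointwiseLipschitz κ φ) {b : M} {y : X} (hy : y ∈ φ b) :
    ∃ g : M → X, Continuous g ∧ IsSelection φ g ∧ ∀ a, dist (g a) y ≤ γ * dist a b := by
  obtain ⟨g, hg, hsel⟩ :=
    (hφ.inter_closedBall_mul_dist hconv hκγ (hlip b y hy)).exists_continuous_selection
      (fun a ↦ (hconv a).inter (convex_closedBall _ _))
      (fun a ↦ (hlip b y hy a).mono (Set.inter_subset_inter_right _
        (Metric.closedBall_subset_closedBall (by gcongr))))
      (fun a ↦ (hcl a).inter Metric.isClosed_closedBall)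
  exact ⟨g, hg, fun a ↦ (hsel a).1, fun a ↦ by simpa [dist_comm a b] using (hsel a).2⟩

/-- A continuous selection can be perturbed to have Lipschitz growth from every point of `T \ S`,
where `T` is uniformly separated, the perturbation being small and vanishing linearly at `S`. -/
theorem exists_perturbed_selection {φ : M → Set X} (hconv : ∀ a, Convex ℝ (φ a)) {γ : ℝ}
    (hsel : ∀ b, ∀ y ∈ φ b,
      ∃ g : M → X, Continuous g ∧ IsSelection φ g ∧ ∀ a, dist (g a) y ≤ γ * dist a b)
    {S T : Set M} (hST : S ⊆ T) {s : ℝ} (hs : 0 < s) (hT : T.Pairwise fun x y ↦ s ≤ dist x y)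
    {f : M → X} (hf : Continuous f) (hfφ : IsSelection φ f) {δ : ℝ} (hδ : 0 < δ) :
    ∃ g : M → X, Continuous g ∧ IsSelection φ g ∧ (∀ a, dist (f a) (g a) ≤ δ) ∧
      (∀ c ∈ S, ∀ a, dist (f a) (g a) ≤ δ * dist a c) ∧
      ∀ b ∈ T \ S, ∀ᶠ a in 𝓝 b, dist (g a) (g b) ≤ γ * dist a b := by
  choose G hGc hGφ hGle using fun b ↦ hsel b (f b) (hfφ b)
  have hGb : ∀ b, G b b = f b := fun b ↦ by simpa using hGle b b
  -- Patches around `T \ S` stay at distance at least `s / 2` from `S`, so `δ * (s / 2)` yields the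
  -- linear bound at `S`.
  set η : ℝ := min δ (δ * (s / 2)) with hη
  have hηpos : 0 < η := by positivity
  have hrad : ∀ b, ∃ r > 0, r ≤ s / 2 ∧ ∀ a ∈ Metric.ball b r, dist (f a) (G b a) ≤ η := by
    intro b
    have h : ∀ᶠ a in 𝓝 b, dist (f a) (G b a) < η :=
      (hf.dist (hGc b)).continuousAt.eventually_lt_const (by simpa [hGb] using hηpos)
    obtain ⟨r, hr, hr'⟩ := Metric.eventually_nhds_iff_ball.1 h
    exact ⟨min r (s / 2), by positivity, min_le_right _ _, fun a ha ↦
      (hr' a (Metric.ball_subset_ball (min_le_left _ _) ha)).le⟩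
  choose r hr hrs hrη using hrad
  have hclosed : IsClosed (T \ S) :=
    Metric.isClosed_of_pairwise_le_dist hs (hT.mono Set.sdiff_subset)
  -- The index `none` carries `f` and avoids `T \ S`, so near `b` only `G b` contributes.
  let U : Option ↥(T \ S) → Set M := fun i ↦ i.elim (T \ S)ᶜ fun b ↦ Metric.ball b (r b)
  let H : Option ↥(T \ S) → M → X := fun i ↦ i.elim f fun b ↦ G b
  have hUo : ∀ i, IsOpen (U i) := by
    rintro (_ | b)
    · exact hclosed.isOpen_compl
    · exact Metric.isOpen_ball
  have hHc : ∀ i, Continuous (H i) := by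
    rintro (_ | b)
    · exact hf
    · exact hGc b
  have hHφ : ∀ i a, H i a ∈ φ a := by
    rintro (_ | b) a
    · exact hfφ a
    · exact hGφ b a
  have hcover : Set.univ ⊆ ⋃ i, U i := fun a _ ↦ by
    by_cases ha : a ∈ T \ S
    · exact Set.mem_iUnion.2 ⟨some ⟨a, ha⟩, Metric.mem_ball_self (hr a)⟩
    · exact Set.mem_iUnion.2 ⟨none, ha⟩
  obtain ⟨ρ, hρ⟩ := PartitionOfUnity.exists_isSubordinate isClosed_univ U hUo hcover
  have hρU : ∀ i a, ρ i a ≠ 0 → a ∈ U i := fun i a h ↦ hρ i (subset_closure h)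
  have hbound : ∀ a (k : ℝ), 0 ≤ k → (∀ b ∈ T \ S, a ∈ Metric.ball b (r b) → η ≤ k) →
      dist (f a) (∑ᶠ i, ρ i a • H i a) ≤ k := by
    intro a k hk hηk
    refine Metric.mem_closedBall'.1 (ρ.finsum_smul_mem_convex (Set.mem_univ a) (fun i hi ↦ ?_)
      (convex_closedBall (f a) k))
    rw [Metric.mem_closedBall']
    rcases i with _ | b
    · simpa [H] using hk
    · exact (hrη b a (hρU _ _ hi)).trans (hηk b b.2 (hρU _ _ hi))
  have heq : ∀ c ∈ S, ∀ b ∈ T \ S, ∀ a ∈ Metric.ball b (r b), s / 2 ≤ dist a c := by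
    intro c hc b hb a ha
    have h1 : s ≤ dist b c := hT hb.1 (hST hc) fun h ↦ hb.2 (h ▸ hc)
    have h2 : dist b a < s / 2 := (Metric.mem_ball'.1 ha).trans_le (hrs b)
    linarith [dist_triangle b a c]
  have hnear : ∀ b ∈ T \ S, ∀ᶠ a in 𝓝 b, dist (∑ᶠ i, ρ i a • H i a) (f b) ≤ γ * dist a b := by
    intro b hb
    have hnone : ∀ᶠ a in 𝓝 b, a ∉ tsupport (ρ none) :=
      (isClosed_tsupport _).isOpen_compl.mem_nhds fun h ↦ hρ none h hb
    filter_upwards [hnone, Metric.ball_mem_nhds b (half_pos hs)] with a ha hab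
    refine ρ.finsum_smul_mem_convex (Set.mem_univ a) (fun i hi ↦ ?_)
      (convex_closedBall (f b) (γ * dist a b))
    rcases i with _ | c
    · exact absurd (subset_closure hi) ha
    · obtain rfl : (c : M) = b := by
        by_contra hcb
        have h1 : s ≤ dist (c : M) b := hT c.2.1 hb.1 hcb
        have h2 : dist (c : M) a < s / 2 :=
          (Metric.mem_ball'.1 (hρU _ _ hi)).trans_le (hrs c)
        linarith [dist_triangle (c : M) a b, Metric.mem_ball.1 hab]
      exact hGle c a
  refine ⟨fun a ↦ ∑ᶠ i, ρ i a • H i a,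
    hρ.continuous_finsum_smul hUo fun i ↦ (hHc i).continuousOn,
    fun a ↦ ρ.finsum_smul_mem_convex (Set.mem_univ a) (fun i _ ↦ hHφ i a) (hconv a),
    fun a ↦ hbound a δ hδ.le fun _ _ _ ↦ min_le_left _ _,
    fun c hc a ↦ hbound a _ (by positivity) fun b hb ha ↦ (min_le_right _ _).trans
      (mul_le_mul_of_nonneg_left (heq c hc b hb a ha) hδ.le), fun b hb ↦ ?_⟩
  have hb0 : ∑ᶠ i, ρ i b • H i b = f b := by simpa using (hnear b hb).self_of_nhds
  simpa only [hb0] using hnear b hb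

end LipschitzSelection

/-! ### Separated nets. -/

section Separated

variable {M : Type*} [MetricSpace M]

/-- A separated set extends to a separated set that is also a net. -/
theorem exists_separated_net_superset {s : ℝ} {S : Set M}
    (hS : S.Pairwise fun x y ↦ s ≤ dist x y) :
    ∃ T, S ⊆ T ∧ T.Pairwise (fun x y ↦ s ≤ dist x y) ∧ ∀ a ∉ T, ∃ b ∈ T, dist a b < s := by
  obtain ⟨T, hST, hT⟩ := zorn_subset_nonempty {T : Set M | T.Pairwise fun x y ↦ s ≤ dist x y}
    (fun c hc hchain _ ↦ ⟨⋃₀ c, (Set.pairwise_sUnion hchain.directedOn).2 fun t ht ↦ hc ht,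
      fun t ht ↦ Set.subset_sUnion_of_mem ht⟩) S hS
  refine ⟨T, hST, hT.prop, fun a ha ↦ ?_⟩
  by_contra! h
  have hins : (insert a T).Pairwise fun x y ↦ s ≤ dist x y :=
    hT.prop.insert fun b hb _ ↦ ⟨h b hb, by simpa [dist_comm] using h b hb⟩
  exact ha (hT.le_of_ge hins (Set.subset_insert a T) (Set.mem_insert a T))

/-- There is an increasing sequence of uniformly separated sets with dense union. -/
theorem exists_separated_seq_dense (M : Type*) [MetricSpace M] :
    ∃ S : ℕ → Set M, S 0 = ∅ ∧ (∀ n, S n ⊆ S (n + 1)) ∧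
      (∀ n, (S n).Pairwise fun x y ↦ (1 / 2 : ℝ) ^ n ≤ dist x y) ∧ Dense (⋃ n, S n) := by
  choose! N hN using fun (n : ℕ) (S : Set M)
      (h : S.Pairwise fun x y ↦ (1 / 2 : ℝ) ^ (n + 1) ≤ dist x y) ↦ exists_separated_net_superset h
  have hmono : ∀ (n : ℕ) (S : Set M), S.Pairwise (fun x y ↦ (1 / 2 : ℝ) ^ n ≤ dist x y) →
      S.Pairwise fun x y ↦ (1 / 2 : ℝ) ^ (n + 1) ≤ dist x y := fun n S h ↦
    h.mono' fun x y hxy ↦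
      (pow_le_pow_of_le_one (by norm_num) (by norm_num) n.le_succ : (1 / 2 : ℝ) ^ (n + 1) ≤ _).trans hxy
  let S : ℕ → Set M := fun n ↦ Nat.rec ∅ N n
  have hS : ∀ n, (S n).Pairwise fun x y ↦ (1 / 2 : ℝ) ^ n ≤ dist x y := by
    intro n
    induction n with
    | zero => exact Set.pairwise_empty _
    | succ n ih => exact (hN n (S n) (hmono n _ ih)).2.1
  have hstep := fun n ↦ hN n (S n) (hmono n _ (hS n))
  refine ⟨S, rfl, fun n ↦ (hstep n).1, hS, Metric.dense_iff.2 fun a ε hε ↦ ?_⟩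
  obtain ⟨n, hn⟩ := exists_pow_lt_of_lt_one hε (by norm_num : (1 / 2 : ℝ) < 1)
  by_cases ha : a ∈ S (n + 1)
  · exact ⟨a, Metric.mem_ball_self hε, Set.mem_iUnion.2 ⟨n + 1, ha⟩⟩
  · obtain ⟨b, hb, hab⟩ := (hstep n).2.2 a ha
    refine ⟨b, Metric.mem_ball'.2 (hab.trans ((pow_lt_pow_right_of_lt_one₀ (by norm_num)
      (by norm_num) n.lt_succ_self).trans hn)), Set.mem_iUnion.2 ⟨n + 1, hb⟩⟩

end Separated

/-! ### Iteration over the nets and conclusion. -/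

theorem PointwiseLipschitzAt.of_eventually_dist_le {M N : Type*} [MetricSpace M] [MetricSpace N]
    {β : ℝ≥0} {f : M → N} {b : M} (h : ∀ᶠ a in 𝓝 b, dist (f a) (f b) ≤ β * dist a b) :
    PointwiseLipschitzAt β f b := by
  obtain ⟨ρ, hρ, hball⟩ := Metric.eventually_nhds_iff_ball.1 h
  refine limsup_le_of_le (h := ?_)
  filter_upwards [Ioo_mem_nhdsGT hρ] with r hr
  have hr0 : ENNReal.ofReal r ≠ 0 := by simpa using hr.1
  have hsup : ⨆ a ∈ Metric.closedBall b r, edist (f b) (f a) ≤ β * ENNReal.ofReal r := by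
    refine iSup₂_le fun a ha ↦ ?_
    rw [edist_comm, edist_dist, ← ENNReal.ofReal_coe_nnreal, ← ENNReal.ofReal_mul β.coe_nonneg]
    exact ENNReal.ofReal_le_ofReal ((hball a (Metric.closedBall_subset_ball hr.2 ha)).trans
      (mul_le_mul_of_nonneg_left ha β.coe_nonneg))
  calc (ENNReal.ofReal r)⁻¹ * ⨆ a ∈ Metric.closedBall b r, edist (f b) (f a)
      ≤ (ENNReal.ofReal r)⁻¹ * (β * ENNReal.ofReal r) := by gcongr
    _ = β := by
      rw [mul_comm (β : ℝ≥0∞), ← mul_assoc, ENNReal.inv_mul_cancel hr0 ENNReal.ofReal_ne_top,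
        one_mul]

/-- Given continuous selections with Lipschitz growth of slope `γ` through all points of the graph,
there is a continuous selection near a given one with Lipschitz growth of slope `γ + ε` from all
points of a dense set. -/
theorem exists_selection_dense_dist_le {M X : Type*} [MetricSpace M] [NormedAddCommGroup X]
    [NormedSpace ℝ X] [CompleteSpace X] {φ : M → Set X} (hconv : ∀ a, Convex ℝ (φ a))
    (hcl : ∀ a, IsClosed (φ a)) {γ ε : ℝ} (hε : 0 < ε)
    (hsel : ∀ b, ∀ y ∈ φ b,
      ∃ g : M → X, Continuous g ∧ IsSelection φ g ∧ ∀ a, dist (g a) y ≤ γ * dist a b)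
    {f₀ : M → X} (hf₀ : Continuous f₀) (hf₀φ : IsSelection φ f₀) :
    ∃ f : M → X, IsSelection φ f ∧ Continuous f ∧ (∀ a, dist (f₀ a) (f a) ≤ ε) ∧
      ∃ S : Set M, Dense S ∧
        ∀ b ∈ S, ∀ᶠ a in 𝓝 b, dist (f a) (f b) ≤ (γ + ε) * dist a b := by
  obtain ⟨S, hS0, hSmono, hSsep, hSdense⟩ := exists_separated_seq_dense M
  choose! N hNc hNφ hNle hNS hNnear using fun (n : ℕ) (f : M → X)
      (h : Continuous f ∧ IsSelection φ f) ↦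
    exists_perturbed_selection hconv hsel (hSmono n)
      (by positivity : (0 : ℝ) < (1 / 2) ^ (n + 1)) (hSsep (n + 1)) h.1 h.2
      (by positivity : (0 : ℝ) < ε / 2 / 2 ^ n)
  let F : ℕ → M → X := fun n ↦ Nat.rec f₀ N n
  have hF : ∀ n, Continuous (F n) ∧ IsSelection φ (F n) := by
    intro n
    induction n with
    | zero => exact ⟨hf₀, hf₀φ⟩
    | succ n ih => exact ⟨hNc n _ ih, hNφ n _ ih⟩
  obtain ⟨f, hfc, hf, hle⟩ := exists_continuous_limit_of_dist_le (fun n ↦ (hF n).1)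
    (fun n a ↦ hNle n (F n) (hF n) a)
  refine ⟨f, fun a ↦ (hcl a).mem_of_tendsto (hf a) (Eventually.of_forall fun n ↦ (hF n).2 a), hfc,
    fun a ↦ (hle 0 a).trans_eq (by simp), ⋃ n, S n, hSdense, fun b hb ↦ ?_⟩
  -- Once `b` is in the net, the corrections are at most a geometric series times `dist a b`; in
  -- particular the value at `b` is frozen.
  have htail : ∀ n, b ∈ S n → ∀ a, dist (F n a) (f a) ≤ ε * dist a b := by
    intro n hn a
    refine dist_le_of_le_geometric_two_of_tendsto₀ (f := fun k ↦ F (n + k) a) (fun k ↦ ?_)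
      ((hf a).comp (tendsto_add_atTop_nat n |>.congr fun k ↦ add_comm k n))
    have hbk : b ∈ S (n + k) := monotone_nat_of_le_succ hSmono (Nat.le_add_right n k) hn
    calc dist (F (n + k) a) (F (n + (k + 1)) a)
        ≤ ε / 2 / 2 ^ (n + k) * dist a b := hNS (n + k) _ (hF _) b hbk a
      _ ≤ ε / 2 / 2 ^ k * dist a b := by
          gcongr
          · norm_num
          · omega
      _ = ε * dist a b / 2 / 2 ^ k := by ring
  -- The stage at which `b` enters, which exists because `S 0` is empty.
  obtain ⟨n, hn⟩ : ∃ n, b ∈ S (n + 1) \ S n := by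
    by_contra! hno
    have : ∀ n, b ∉ S n := fun n ↦ by
      induction n with
      | zero => simp [hS0]
      | succ n ih => exact fun h ↦ hno n ⟨h, ih⟩
    exact (Set.mem_iUnion.1 hb).elim this
  have hfb : F (n + 1) b = f b := by simpa using htail (n + 1) hn.1 b
  filter_upwards [hNnear n (F n) (hF n) b hn] with a ha
  change dist (F (n + 1) a) (F (n + 1) b) ≤ _ at ha
  rw [hfb] at ha
  have h1 := htail (n + 1) hn.1 a
  linarith [dist_triangle_left (f a) (f b) (F (n + 1) a)]

theorem mainTheorem4 {M X : Type*} [MetricSpace M] [BoundedSpace M]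
    [NormedAddCommGroup X] [NormedSpace ℝ X] [CompleteSpace X]
    (α : ℝ≥0) (φ : M → Set X)
    (hφ_nonempty : ∀ a : M, (φ a).Nonempty)
    (hφ_closed : ∀ a : M, IsClosed (φ a))
    (hφ_convex : ∀ a : M, Convex ℝ (φ a))
    (hφ_lhc : LowerHemicontinuous φ)
    (hφ_lip : ∀ ε : ℝ≥0, 0 < ε → LowerPointwiseLipschitz (α + ε) φ)
    (β : ℝ≥0) (hβ : α < β) :
    ∃ f : M → X, IsSelection φ f ∧ Continuous f ∧ Bornology.IsBounded (Set.range f) ∧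
      ∃ S : Set M, Dense S ∧ PointwiseLipschitzOn β f S := by
  rcases isEmpty_or_nonempty M with hM | ⟨⟨b₀⟩⟩
  · exact ⟨fun _ ↦ 0, fun a ↦ hM.elim a, continuous_const, by simp [Set.range_eq_empty], Set.univ,
      dense_univ, fun a ↦ hM.elim a⟩
  obtain ⟨γ, hαγ, hγβ⟩ := exists_between hβ
  obtain ⟨κ, hακ, hκγ⟩ := exists_between hαγ
  have hκ : LowerPointwiseLipschitz κ φ := by
    simpa [add_tsub_cancel_of_le hακ.le] using hφ_lip (κ - α) (tsub_pos_of_lt hακ)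
  have hsel : ∀ b, ∀ y ∈ φ b,
      ∃ g : M → X, Continuous g ∧ IsSelection φ g ∧ ∀ a, dist (g a) y ≤ γ * dist a b :=
    fun b y hy ↦ hφ_lhc.exists_continuous_selection_dist_le hφ_convex hφ_closed hκγ hκ hy
  obtain ⟨y₀, hy₀⟩ := hφ_nonempty b₀
  obtain ⟨f₀, hf₀, hf₀φ, hf₀le⟩ := hsel b₀ y₀ hy₀
  -- With ε = β - γ the final slope is β; boundedness passes from `f₀`, which has linear growth on a
  -- bounded space.
  obtain ⟨f, hfφ, hfc, hff₀, S, hS, hfS⟩ := exists_selection_dense_dist_le hφ_convex hφ_closed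
    (sub_pos.2 (NNReal.coe_lt_coe.2 hγβ)) hsel hf₀ hf₀φ
  refine ⟨f, hfφ, hfc, ?_, S, hS, fun b hb ↦ .of_eventually_dist_le ?_⟩
  · refine (Metric.isBounded_closedBall (x := y₀)
      (r := (β - γ : ℝ) + γ * Metric.diam (Set.univ : Set M))).subset ?_
    rintro _ ⟨a, rfl⟩
    have h1 : dist a b₀ ≤ Metric.diam (Set.univ : Set M) :=
      Metric.dist_le_diam_of_mem (Bornology.IsBounded.all _) (Set.mem_univ a)
        (Set.mem_univ b₀)
    calc dist (f a) y₀ ≤ dist (f₀ a) (f a) + dist (f₀ a) y₀ := dist_triangle_left _ _ _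
      _ ≤ (β - γ : ℝ) + γ * Metric.diam (Set.univ : Set M) := by
        gcongr
        · exact hff₀ a
        · exact (hf₀le a).trans (by gcongr)
  · simpa using hfS b hb
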